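/- Let $q\in\mathbb C$ with $|q|<1$, write $(a;q)_n=\prod_{j=0}^{n-1}(1-aq^j)$, $(a;q)_\infty=\prod_{j\ge0}(1-aq^j)$, $(a_1,\dots,a_m;q)_n=(a_1;q)_n\cdots(a_m;q)_n$ (also for $n=\infty$), and $(a)_n=(a;q)_n$. Let $i,k,\ell$ be positive integers with $1\le i\le k-1$. For $n_1,\dots,n_k\ge 0$ put $N_j=n_j+n_{j+1}+\cdots+n_k$. Then $$\frac{1}{(q^{k-i},q^{k+i},q^{2k};q^{2k})_\infty}\sum_{n=-\ell+1}^{\ell-1}(-1)^nq^{kn^2-in} =1+\frac{2(-1)^{\ell-1}q^{k\ell^2-i\ell}}{(q^{k-i},q^{k+i},q^{2k};q^{2k})_\infty} \sum_{n_1,\dots,n_k\ge0}\frac{(-1)^{N_1}(q,-q;q)_{N_1+\ell-1}\,q^{2\ell(N_2+\cdots+N_k)+N_2^2+\cdots+N_k^2-N_2-\cdots-N_i}}{(q)_{n_1}(q)_{n_2}\cdots(q)_{n_k}\,(q)_{n_k+2\ell-1}} .$$ Here the multiple series, whose terms do not tend to $0$ as $n_1\to\infty$ with $n_2=\cdots=n_k=0$,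 is understood as an Abel sum: writing $t(n_1,\dots,n_k)$ for its general term, the series $\sum_{n_1,\dots,n_k\ge0}x^{N_1}t(n_1,\dots,n_k)$ converges absolutely for $0\le x<1$, the limit of its sum as $x\to1^-$ exists, and this limit is the value of the multiple series. -/

import Mathlib

open Filter Topology

/-- The finite `q`-shifted factorial `(a; q)_n = (1 - a)(1 - a q) ⋯ (1 - a q ^ (n - 1))`. -/
noncomputable def qPoch (a q : ℂ) (n : ℕ) : ℂ :=
  ∏ j ∈ Finset.range n, (1 - a * q ^ j)

/-- The infinite `q`-shifted factorial `(a; q)_∞ = ∏_{n ≥ 0} (1 - a q ^ n)`, for `|q| < 1`. -/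
noncomputable def qPochInf (a q : ℂ) : ℂ :=
  ∏' n : ℕ, (1 - a * q ^ n)

/-- The infinite product defining `(a; q)_∞` converges when `|q| < 1`. -/
theorem multipliable_qPochInf (a q : ℂ) (hq : ‖q‖ < 1) :
    Multipliable fun n : ℕ => 1 - a * q ^ n := by
  have h : Summable fun n : ℕ => ‖-(a * q ^ n)‖ := by
    simpa [norm_mul, norm_pow] using
      (summable_geometric_of_lt_one (norm_nonneg q) hq).mul_left ‖a‖
  simpa [sub_eq_add_neg] using multipliable_one_add_of_summable h

/-- The theta product `(q^(k-i), q^(k+i), q^(2k); q^(2k))_∞` (used for `i ≤ k`). -/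
noncomputable def evenProduct (k i : ℕ) (q : ℂ) : ℂ :=
  qPochInf (q ^ (k - i)) (q ^ (2 * k)) * qPochInf (q ^ (k + i)) (q ^ (2 * k)) *
    qPochInf (q ^ (2 * k)) (q ^ (2 * k))

/-- `tailSum n j` is `N_j = n_j + n_{j+1} + ⋯ + n_k`, where `n_1, …, n_k` are the entries
`n 0, …, n (k - 1)` of the tuple. In particular `tailSum n k` is the last entry `n_k`. -/
def tailSum {k : ℕ} (n : Fin k → ℕ) (j : ℕ) : ℕ :=
  ∑ r : Fin k, if j ≤ (r : ℕ) + 1 then n r else 0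

/-- The exponent `2 ℓ (N_2 + ⋯ + N_k) + N_2² + ⋯ + N_k² - N_2 - ⋯ - N_i`. -/
def evenExponent (k i ℓ : ℕ) (n : Fin k → ℕ) : ℤ :=
  2 * (ℓ : ℤ) * ∑ j ∈ Finset.Icc 2 k, (tailSum n j : ℤ)
    + ∑ j ∈ Finset.Icc 2 k, (tailSum n j : ℤ) ^ 2
    - ∑ j ∈ Finset.Icc 2 i, (tailSum n j : ℤ)

/-- The general term
`(-1)^{N_1} (q, -q; q)_{N_1+ℓ-1} q^{…} / ((q)_{n_1} ⋯ (q)_{n_k} (q)_{n_k+2ℓ-1})`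
of the multisum (used for `ℓ ≥ 1`). -/
noncomputable def evenTerm (k i ℓ : ℕ) (q : ℂ) (n : Fin k → ℕ) : ℂ :=
  (-1) ^ tailSum n 1 *
      (qPoch q q (tailSum n 1 + ℓ - 1) * qPoch (-q) q (tailSum n 1 + ℓ - 1)) *
      q ^ evenExponent k i ℓ n /
    ((∏ r : Fin k, qPoch q q (n r)) * qPoch q q (tailSum n k + 2 * ℓ - 1))

/-- `V` is the Abel sum of the multiple series `∑ f (n_1, …, n_k)`, graded by
`N_1 = n_1 + ⋯ + n_k`: for `0 ≤ x < 1` the series `∑ x^{N_1} f (n_1, …, n_k)` converges absolutely,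
and its sum tends to `V` as `x → 1` from below. -/
def HasAbelMultisum {k : ℕ} (f : (Fin k → ℕ) → ℂ) (V : ℂ) : Prop :=
  (∀ x : ℝ, 0 ≤ x → x < 1 → Summable fun n : Fin k → ℕ => (x : ℂ) ^ tailSum n 1 * f n) ∧
    Tendsto (fun x : ℝ => ∑' n : Fin k → ℕ, (x : ℂ) ^ tailSum n 1 * f n) (𝓝[<] 1) (𝓝 V)

open Finset.HasAntidiagonal (antidiagonal mem_antidiagonal)
open Finset.Nat (antidiagonalTuple mem_antidiagonalTuple)

/-! The theta series over all integers equals the product in the denominator (Jacobi), so the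
identity says that the multisum represents the tail `|n| ≥ ℓ`. Put `r = ℓ - 1`, `e = 2ℓ - 1`.

Grade the multisum by `N = N_1`. The inner sum over tuples is an iterated Bailey chain, hence has
the form `∑ α_n / ((q)_{N-n} (q)_{N+n+e})` with an explicit `α` (`chainSum_eq_baileyBeta`).
Inserting this and exchanging sums leaves, for each `n`, a `q`-Gauss series of argument `-x` in
which `n` and `r` enter only through `n + r`. At `x = 1` it lies on the boundary of convergence, and
its Abel value is always `1/2` (`tendsto_qGaussSum`).

The Abel sum is therefore `(1/2) ∑ (-1)^n α_n`, where the limit in `x` passes inside by a bound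
uniform in `n` and `x` (`tendsto_tsum_baileyBeta`). Each `α_n` with `n ≥ 1` is a difference of two
powers of `q`; after regrouping, these are the theta terms of index `±(n + ℓ)` divided by the
prefactor (`tsum_chainCoeff`). `jacobi_triple_product` then turns the tail into product minus
partial sum. -/

/-! ### Nonvanishing and uniform bounds for `q`-shifted factorials. -/

theorem qPoch_zero (a q : ℂ) : qPoch a q 0 = 1 := by simp [qPoch]

theorem qPoch_succ (a q : ℂ) (n : ℕ) : qPoch a q (n + 1) = qPoch a q n * (1 - a * q ^ n) := by
  simp [qPoch, Finset.prod_range_succ]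

theorem qPoch_self_succ (q : ℂ) (n : ℕ) :
    qPoch q q (n + 1) = qPoch q q n * (1 - q ^ (n + 1)) := by
  rw [qPoch_succ, pow_succ']

theorem one_sub_pow_succ_ne_zero {q : ℂ} (hq : ‖q‖ < 1) (n : ℕ) : 1 - q ^ (n + 1) ≠ 0 := by
  intro h
  have h1 : q ^ (n + 1) = 1 := (sub_eq_zero.mp h).symm
  have h2 : ‖q‖ ^ (n + 1) < 1 := pow_lt_one₀ (norm_nonneg q) hq n.succ_ne_zero
  rw [← norm_pow, h1, norm_one] at h2
  exact lt_irrefl _ h2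

theorem qPoch_self_ne_zero {q : ℂ} (hq : ‖q‖ < 1) (n : ℕ) : qPoch q q n ≠ 0 := by
  induction n with
  | zero => simp [qPoch_zero]
  | succ n ih =>
    rw [qPoch_self_succ]
    exact mul_ne_zero ih (one_sub_pow_succ_ne_zero hq n)

theorem tendsto_qPoch (a : ℂ) {q : ℂ} (hq : ‖q‖ < 1) :
    Tendsto (qPoch a q) atTop (𝓝 (qPochInf a q)) :=
  (multipliable_qPochInf a q hq).hasProd.tendsto_prod_nat

theorem qPochInf_ne_zero {a q : ℂ} (hq : ‖q‖ < 1) (h : ∀ n : ℕ, 1 - a * q ^ n ≠ 0) :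
    qPochInf a q ≠ 0 := by
  have hs : Summable fun n : ℕ => ‖-(a * q ^ n)‖ := by
    simpa [norm_mul, norm_pow] using
      (summable_geometric_of_lt_one (norm_nonneg q) hq).mul_left ‖a‖
  have := tprod_one_add_ne_zero_of_summable (f := fun n : ℕ => -(a * q ^ n))
    (by simpa [sub_eq_add_neg] using h) hs
  simpa [qPochInf, sub_eq_add_neg] using this

theorem qPochInf_pow_ne_zero {q : ℂ} (hq : ‖q‖ < 1) {s t : ℕ} (hs : 0 < s) (ht : 0 < t) :
    qPochInf (q ^ s) (q ^ t) ≠ 0 := by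
  have ht' : ‖q ^ t‖ < 1 := by
    rw [norm_pow]; exact pow_lt_one₀ (norm_nonneg q) hq ht.ne'
  refine qPochInf_ne_zero ht' fun n => ?_
  obtain ⟨s, rfl⟩ := Nat.exists_eq_succ_of_ne_zero hs.ne'
  have := one_sub_pow_succ_ne_zero hq (s + t * n)
  rwa [← pow_mul, ← pow_add, show s.succ + t * n = s + t * n + 1 by omega]

theorem exists_norm_le_of_tendsto {u : ℕ → ℂ} {l : ℂ} (h : Tendsto u atTop (𝓝 l)) :
    ∃ C : ℝ, 1 ≤ C ∧ ∀ n, ‖u n‖ ≤ C := by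
  obtain ⟨C, hC⟩ := (Metric.isBounded_range_of_tendsto u h).exists_norm_le
  exact ⟨max 1 C, le_max_left _ _, fun n => (hC _ ⟨n, rfl⟩).trans (le_max_right _ _)⟩

theorem exists_norm_qPoch_le (a : ℂ) {q : ℂ} (hq : ‖q‖ < 1) :
    ∃ C : ℝ, 1 ≤ C ∧ ∀ n, ‖qPoch a q n‖ ≤ C :=
  exists_norm_le_of_tendsto (tendsto_qPoch a hq)

theorem qPochInf_self_ne_zero {q : ℂ} (hq : ‖q‖ < 1) : qPochInf q q ≠ 0 := by
  simpa using qPochInf_pow_ne_zero hq one_pos one_pos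

theorem exists_norm_inv_qPoch_self_le {q : ℂ} (hq : ‖q‖ < 1) :
    ∃ C : ℝ, 1 ≤ C ∧ ∀ n, ‖(qPoch q q n)⁻¹‖ ≤ C :=
  exists_norm_le_of_tendsto ((tendsto_qPoch q hq).inv₀ (qPochInf_self_ne_zero hq))

/-! ### The Bailey chain. -/

theorem sum_antidiagonal_assoc (N : ℕ) (f : ℕ → ℕ → ℕ → ℂ) :
    ∑ p ∈ antidiagonal N, ∑ r ∈ antidiagonal p.2, f p.1 r.1 r.2 =
      ∑ p ∈ antidiagonal N, ∑ r ∈ antidiagonal p.1, f r.1 r.2 p.2 := by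
  rw [Finset.sum_sigma', Finset.sum_sigma']
  refine Finset.sum_nbij' (fun x => ⟨(x.1.1 + x.2.1, x.2.2), (x.1.1, x.2.1)⟩)
    (fun x => ⟨(x.2.1, x.2.2 + x.1.2), (x.2.2, x.1.2)⟩) ?_ ?_ ?_ ?_ ?_
  · rintro ⟨⟨a, b⟩, ⟨c, d⟩⟩ h
    simp only [Finset.mem_sigma, mem_antidiagonal] at h ⊢
    obtain ⟨h1, h2⟩ := h
    constructor
    all_goals try dsimp only at *
    all_goals omega
  · rintro ⟨⟨a, b⟩, ⟨c, d⟩⟩ h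
    simp only [Finset.mem_sigma, mem_antidiagonal] at h ⊢
    obtain ⟨h1, h2⟩ := h
    constructor
    all_goals try dsimp only at *
    all_goals omega
  · rintro ⟨⟨a, b⟩, ⟨c, d⟩⟩ h
    simp only [Finset.mem_sigma, mem_antidiagonal] at h ⊢
    obtain ⟨h1, rfl⟩ := h
    rfl
  · rintro ⟨⟨a, b⟩, ⟨c, d⟩⟩ h
    simp only [Finset.mem_sigma, mem_antidiagonal] at h ⊢
    obtain ⟨h1, rfl⟩ := h
    rfl
  · rintro ⟨⟨a, b⟩, ⟨c, d⟩⟩ h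
    rfl

/-- The limiting `q`-Chu–Vandermonde summation. -/
theorem sum_antidiagonal_qVandermonde {q : ℂ} (hq : ‖q‖ < 1) (K c : ℕ) :
    ∑ p ∈ antidiagonal K,
        q ^ (p.2 ^ 2 + c * p.2) / (qPoch q q p.1 * qPoch q q p.2 * qPoch q q (p.2 + c)) =
      1 / (qPoch q q K * qPoch q q (K + c)) := by
  induction K generalizing c with
  | zero => simp [qPoch_zero]
  | succ K ih =>
    have hP := qPoch_self_ne_zero hq
    have h1 := one_sub_pow_succ_ne_zero hq
    set f : ℕ × ℕ → ℂ := fun p =>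
      q ^ (p.2 ^ 2 + c * p.2) / (qPoch q q p.1 * qPoch q q p.2 * qPoch q q (p.2 + c)) with hf
    have key : (1 - q ^ (K + 1)) * ∑ p ∈ antidiagonal (K + 1), f p =
        ∑ p ∈ antidiagonal K, q ^ (p.2 ^ 2 + (c + 1) * p.2) /
          (qPoch q q p.1 * qPoch q q p.2 * qPoch q q (p.2 + (c + 1))) := by
      -- With `a + b = K + 1`, split `1 - q^(a+b) = (1 - q^b) + q^b (1 - q^a)`. Each part cancels a
      -- factor and shifts an index, and together they form the sum for `K` and `c + 1`.
      have e1 : (1 - q ^ (K + 1)) * ∑ p ∈ antidiagonal (K + 1), f p =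
          ∑ p ∈ antidiagonal (K + 1), f p * (1 - q ^ p.2) +
          ∑ p ∈ antidiagonal (K + 1), f p * (q ^ p.2 * (1 - q ^ p.1)) := by
        rw [Finset.mul_sum, ← Finset.sum_add_distrib]
        refine Finset.sum_congr rfl fun p hp => ?_
        rw [← mem_antidiagonal.mp hp, pow_add]
        ring
      rw [e1, Finset.Nat.sum_antidiagonal_succ', Finset.Nat.sum_antidiagonal_succ]
      simp only [pow_zero, sub_self, mul_zero, zero_add]
      rw [← Finset.sum_add_distrib]
      refine Finset.sum_congr rfl fun p _ => ?_
      obtain ⟨a, b⟩ := p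
      simp only [hf]
      rw [show b + 1 + c = b + c + 1 by ring, show b + (c + 1) = b + c + 1 by ring,
        qPoch_self_succ q a, qPoch_self_succ q b, qPoch_self_succ q (b + c)]
      have := hP a; have := hP b; have := hP (b + c)
      have := h1 a; have := h1 b; have := h1 (b + c)
      field_simp
      ring
    rw [ih] at key
    rw [eq_div_iff (mul_ne_zero (hP _) (hP _)), qPoch_self_succ q K]
    rw [eq_div_iff (mul_ne_zero (hP _) (hP _))] at key
    rw [show K + (c + 1) = K + 1 + c by ring] at key
    linear_combination key

/-- The sequence `β_N = ∑_n α_n / ((q)_{N-n} (q)_{N+n+e})` of a Bailey pair. -/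
noncomputable def baileyBeta (q : ℂ) (e : ℕ) (α : ℕ → ℂ) (N : ℕ) : ℂ :=
  ∑ p ∈ antidiagonal N, α p.2 / (qPoch q q p.1 * qPoch q q (N + p.2 + e))

/-- One step along the Bailey chain. -/
theorem baileyBeta_step {q : ℂ} (hq : ‖q‖ < 1) (e : ℕ) (α : ℕ → ℂ) (N : ℕ) :
    ∑ p ∈ antidiagonal N,
        q ^ (p.2 ^ 2 + e * p.2) / qPoch q q p.1 * baileyBeta q e α p.2 =
      baileyBeta q e (fun n => q ^ (n ^ 2 + e * n) * α n) N := by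
  have h := sum_antidiagonal_assoc N fun a b n =>
    q ^ ((b + n) ^ 2 + e * (b + n)) / qPoch q q a *
      (α n / (qPoch q q b * qPoch q q (b + n + n + e)))
  have hl : ∑ p ∈ antidiagonal N,
        q ^ (p.2 ^ 2 + e * p.2) / qPoch q q p.1 * baileyBeta q e α p.2 =
      ∑ p ∈ antidiagonal N, ∑ r ∈ antidiagonal p.2,
        q ^ ((r.1 + r.2) ^ 2 + e * (r.1 + r.2)) / qPoch q q p.1 *
          (α r.2 / (qPoch q q r.1 * qPoch q q (r.1 + r.2 + r.2 + e))) := by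
    refine Finset.sum_congr rfl fun p _ => ?_
    rw [baileyBeta, Finset.mul_sum]
    refine Finset.sum_congr rfl fun r hr => ?_
    rw [← mem_antidiagonal.mp hr]
  rw [hl]
  refine h.trans ?_
  rw [baileyBeta]
  refine Finset.sum_congr rfl fun p hp => ?_
  obtain ⟨K, n⟩ := p
  have hN : K + n = N := mem_antidiagonal.mp hp
  -- For fixed `n`, `(b+n)² + e(b+n) = (n² + en) + b² + (2n+e)b`, so the inner sum is Vandermonde
  -- with `c = 2n + e`.
  have hV := sum_antidiagonal_qVandermonde hq K (2 * n + e)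
  simp only
  rw [show N + n + e = K + (2 * n + e) by omega]
  calc _ = q ^ (n ^ 2 + e * n) * α n * ∑ p ∈ antidiagonal K,
        q ^ (p.2 ^ 2 + (2 * n + e) * p.2) /
          (qPoch q q p.1 * qPoch q q p.2 * qPoch q q (p.2 + (2 * n + e))) := by
        rw [Finset.mul_sum]
        refine Finset.sum_congr rfl fun r _ => ?_
        rw [show r.2 + n + n + e = r.2 + (2 * n + e) by ring,
          show (r.2 + n) ^ 2 + e * (r.2 + n) =
            n ^ 2 + e * n + (r.2 ^ 2 + (2 * n + e) * r.2) by ring, pow_add _ (n ^ 2 + e * n)]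
        have := qPoch_self_ne_zero hq r.1
        have := qPoch_self_ne_zero hq r.2
        have := qPoch_self_ne_zero hq (r.2 + (2 * n + e))
        field_simp
    _ = _ := by rw [hV]; ring

/-- The sequence `c_n - q^(2n+e-1) c_{n-1}`, where `c_{-1} = 0`. -/
noncomputable def shiftCoeff (q : ℂ) (e : ℕ) (c : ℕ → ℂ) : ℕ → ℂ
  | 0 => c 0
  | n + 1 => c (n + 1) - q ^ (2 * n + e + 1) * c n

/-- Change of the parameter of a Bailey pair. -/
theorem baileyBeta_shift {q : ℂ} (hq : ‖q‖ < 1) (e : ℕ) (c : ℕ → ℂ) (N : ℕ) :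
    baileyBeta q (e + 1) (fun n => c n * (1 - q ^ (2 * n + e + 1))) N =
      baileyBeta q e (shiftCoeff q e c) N := by
  have hP := qPoch_self_ne_zero hq
  have h1 := one_sub_pow_succ_ne_zero hq
  -- Uses `1 - q^(2n+e+1) = (1 - q^(N+n+e+1)) - q^(2n+e+1) (1 - q^(N-n))`; the second part is then
  -- reindexed by `n + 1`.
  have hl : baileyBeta q (e + 1) (fun n => c n * (1 - q ^ (2 * n + e + 1))) N =
      ∑ p ∈ antidiagonal N, c p.2 / (qPoch q q p.1 * qPoch q q (N + p.2 + e)) -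
      ∑ p ∈ antidiagonal N, c p.2 * q ^ (2 * p.2 + e + 1) * (1 - q ^ p.1) /
        (qPoch q q p.1 * qPoch q q (N + p.2 + e + 1)) := by
    rw [baileyBeta, ← Finset.sum_sub_distrib]
    refine Finset.sum_congr rfl fun p hp => ?_
    obtain ⟨K, n⟩ := p
    have hN : K + n = N := mem_antidiagonal.mp hp
    subst hN
    simp only
    rw [← add_assoc (K + n + n) e 1, qPoch_self_succ]
    have := hP K; have := hP (K + n + n + e); have := h1 (K + n + n + e)
    field_simp
    ring
  rw [hl, baileyBeta]
  cases N with
  | zero => simp [shiftCoeff]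
  | succ N =>
    rw [Finset.Nat.sum_antidiagonal_succ' (n := N), Finset.Nat.sum_antidiagonal_succ (n := N),
      Finset.Nat.sum_antidiagonal_succ' (n := N)]
    simp only [shiftCoeff, pow_zero, sub_self, mul_zero, zero_div, zero_add, sub_div,
      Finset.sum_sub_distrib]
    rw [add_sub_assoc]
    congr 2
    refine Finset.sum_congr rfl fun p _ => ?_
    rw [qPoch_self_succ q p.1, show N + 1 + p.2 + e + 1 = N + 1 + (p.2 + 1) + e by ring]
    have := hP p.1; have := hP (N + 1 + (p.2 + 1) + e); have := h1 p.1
    field_simp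

/-- The iterated sums over `N_2 ≥ ⋯ ≥ N_{k+1}` with weights `q^(N_j² + ε_j N_j)`. -/
noncomputable def chainSum (q : ℂ) (e : ℕ) : (ℕ → ℕ) → ℕ → ℕ → ℂ
  | _, 0, N => 1 / (qPoch q q N * qPoch q q (N + e))
  | ε, k + 1, N => ∑ p ∈ antidiagonal N,
      q ^ (p.2 ^ 2 + ε 0 * p.2) / qPoch q q p.1 * chainSum q e (fun j => ε (j + 1)) k p.2

/-- For `k = 0`, changing the parameter to `e` makes `c_n = q^(n²+en)` telescope to the unit
sequence, because `c_{n+1} = q^(2n+e+1) c_n`. Every further step multiplies `α_n` by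
`q^(n²+(e+1)n)`. -/
theorem chainSum_const {q : ℂ} (hq : ‖q‖ < 1) (e k N : ℕ) :
    chainSum q e (fun _ => e + 1) k N =
      baileyBeta q (e + 1) (fun n =>
        q ^ (k * (n ^ 2 + (e + 1) * n) + (n ^ 2 + e * n)) * (1 - q ^ (2 * n + e + 1))) N := by
  induction k generalizing N with
  | zero =>
    rw [baileyBeta_shift hq, chainSum, baileyBeta]
    rw [Finset.sum_eq_single (N, 0)]
    · simp [shiftCoeff]
    · rintro ⟨a, b⟩ h h'
      rcases b with _ | b
      · simp at h; simp [h] at h'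
      · simp only [shiftCoeff, ← pow_add]
        rw [show 0 * ((b + 1) ^ 2 + (e + 1) * (b + 1)) + ((b + 1) ^ 2 + e * (b + 1)) =
          2 * b + e + 1 + (0 * (b ^ 2 + (e + 1) * b) + (b ^ 2 + e * b)) by ring]
        simp
    · simp
  | succ k ih =>
    rw [chainSum]
    simp only [ih]
    rw [baileyBeta_step hq]
    congr 1
    funext n
    rw [← mul_assoc, ← pow_add]
    congr 2
    ring

/-- The coefficients `q^(i(n²+en)) (u_n - u_{n-1})`, where `u_n = q^(κ(n²+(e+1)n))`, `u_{-1} = 0`. -/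
noncomputable def chainCoeff (q : ℂ) (e i κ : ℕ) : ℕ → ℂ
  | 0 => 1
  | n + 1 => q ^ (i * ((n + 1) ^ 2 + e * (n + 1))) *
      (q ^ (κ * ((n + 1) ^ 2 + (e + 1) * (n + 1))) - q ^ (κ * (n ^ 2 + (e + 1) * n)))

/-- From the inside out: `κ` steps at parameter `e + 1`, one change of parameter to `e`, then `m`
steps at `e`. The change of parameter creates the difference in `chainCoeff` and contributes one
factor `q^(n²+en)`, whence `m + 1`. -/
theorem chainSum_eq_baileyBeta {q : ℂ} (hq : ‖q‖ < 1) (e κ m N : ℕ) :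
    chainSum q e (fun j => if j < m then e else e + 1) (m + κ) N =
      baileyBeta q e (chainCoeff q e (m + 1) κ) N := by
  induction m generalizing N with
  | zero =>
    simp only [Nat.not_lt_zero, if_false, zero_add]
    rw [chainSum_const hq, baileyBeta_shift hq]
    congr 1
    funext n
    cases n with
    | zero => simp [shiftCoeff, chainCoeff]
    | succ n =>
      simp only [shiftCoeff, chainCoeff, mul_sub, ← pow_add]
      congr 2 <;> ring
  | succ m ih =>
    rw [show m + 1 + κ = m + κ + 1 by ring, chainSum]
    simp only [Nat.add_lt_add_iff_right, Nat.zero_lt_succ, if_true, ih]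
    rw [baileyBeta_step hq]
    congr 1
    funext n
    cases n with
    | zero => simp [chainCoeff]
    | succ n =>
      simp only [chainCoeff]
      rw [← mul_assoc, ← pow_add]
      congr 2
      ring

/-! ### Abel summation of the boundary `q`-Gauss series. -/

theorem summable_neg_pow_mul {a : ℕ → ℂ} {C : ℝ} (ha : ∀ m, ‖a m‖ ≤ C) {x : ℝ} (h0 : 0 ≤ x)
    (h1 : x < 1) : Summable fun m => (-(x : ℂ)) ^ m * a m := by
  refine Summable.of_norm_bounded ((summable_geometric_of_lt_one h0 h1).mul_right C) fun m => ?_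
  rw [norm_mul, norm_pow, norm_neg, Complex.norm_real, Real.norm_of_nonneg h0]
  exact mul_le_mul_of_nonneg_left (ha m) (pow_nonneg h0 m)

/-- Alternating power series with coefficients of geometrically decaying increments are bounded
on `[0, 1)`. -/
theorem norm_tsum_neg_pow_mul_le {a : ℕ → ℂ} {A B ρ : ℝ} (hρ0 : 0 ≤ ρ) (hρ : ρ < 1)
    (ha : ∀ m, ‖a m‖ ≤ A) (hd : ∀ m, ‖a (m + 1) - a m‖ ≤ B * ρ ^ m)
    {x : ℝ} (h0 : 0 ≤ x) (h1 : x < 1) :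
    ‖∑' m, (-(x : ℂ)) ^ m * a m‖ ≤ A + B * (1 - ρ)⁻¹ := by
  have hs := summable_neg_pow_mul ha h0 h1
  have hs1 : Summable fun m => (-(x : ℂ)) ^ m * a (m + 1) :=
    summable_neg_pow_mul (fun m => ha (m + 1)) h0 h1
  have hB : 0 ≤ B := by simpa using (norm_nonneg _).trans (hd 0)
  -- The factor `1 + x` has modulus at least `1` and replaces the coefficients by their summable
  -- increments.
  have e : (1 + (x : ℂ)) * ∑' m, (-(x : ℂ)) ^ m * a m =
      a 0 + -(x : ℂ) * ∑' m, (-(x : ℂ)) ^ m * (a (m + 1) - a m) := by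
    simp only [mul_sub]
    rw [hs1.tsum_sub hs, mul_sub]
    have : -(x : ℂ) * ∑' m, (-(x : ℂ)) ^ m * a (m + 1) = ∑' m, (-(x : ℂ)) ^ m * a m - a 0 := by
      rw [hs.tsum_eq_zero_add, ← tsum_mul_left]
      simp only [pow_zero, one_mul, add_sub_cancel_left]
      exact tsum_congr fun m => by ring
    rw [this]
    ring
  have hb : ‖∑' m, (-(x : ℂ)) ^ m * (a (m + 1) - a m)‖ ≤ B * (1 - ρ)⁻¹ := by
    refine tsum_of_norm_bounded ((hasSum_geometric_of_lt_one hρ0 hρ).mul_left B) fun m => ?_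
    rw [norm_mul, norm_pow, norm_neg, Complex.norm_real, Real.norm_of_nonneg h0]
    exact (mul_le_of_le_one_left (norm_nonneg _) (pow_le_one₀ h0 h1.le)).trans (hd m)
  have hx : ‖1 + (x : ℂ)‖ = 1 + x := by
    rw [← Complex.ofReal_one, ← Complex.ofReal_add, Complex.norm_real,
      Real.norm_of_nonneg (by positivity)]
  calc _ ≤ ‖1 + (x : ℂ)‖ * ‖∑' m, (-(x : ℂ)) ^ m * a m‖ :=
        le_mul_of_one_le_left (norm_nonneg _) (by rw [hx]; linarith)
    _ = ‖a 0 + -(x : ℂ) * ∑' m, (-(x : ℂ)) ^ m * (a (m + 1) - a m)‖ := by rw [← norm_mul, e]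
    _ ≤ ‖a 0‖ + x * ‖∑' m, (-(x : ℂ)) ^ m * (a (m + 1) - a m)‖ := by
        refine (norm_add_le _ _).trans ?_
        rw [norm_mul, norm_neg, Complex.norm_real, Real.norm_of_nonneg h0]
    _ ≤ _ := add_le_add (ha 0) ((mul_le_of_le_one_left (norm_nonneg _) h1.le).trans hb)

/-- `(q, -q; q)_{m+s} / ((q)_m (q)_{m+d})`. -/
noncomputable def qGaussCoeff (q : ℂ) (s d m : ℕ) : ℂ :=
  qPoch q q (m + s) * qPoch (-q) q (m + s) / (qPoch q q m * qPoch q q (m + d))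

/-- `∑_m (-x)^m (q, -q; q)_{m+s} / ((q)_m (q)_{m+d})`. -/
noncomputable def qGaussSum (q : ℂ) (s d : ℕ) (x : ℝ) : ℂ :=
  ∑' m : ℕ, (-(x : ℂ)) ^ m * qGaussCoeff q s d m

theorem qPoch_mul_qPoch_neg_succ (q : ℂ) (n : ℕ) :
    qPoch q q (n + 1) * qPoch (-q) q (n + 1) =
      qPoch q q n * qPoch (-q) q n * (1 - q ^ (2 * (n + 1))) := by
  rw [qPoch_succ, qPoch_succ]
  ring

/-- The increment contains `q^m` times a signed sum of four powers of `q`, whence the `4`.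
Independence of `s` and `d` is what later permits dominated convergence in `n`. -/
theorem exists_norm_qGaussCoeff_le {q : ℂ} (hq : ‖q‖ < 1) :
    ∃ C : ℝ, 1 ≤ C ∧ (∀ s d m, ‖qGaussCoeff q s d m‖ ≤ C) ∧
      ∀ s d m, ‖qGaussCoeff q s d (m + 1) - qGaussCoeff q s d m‖ ≤ 4 * C * ‖q‖ ^ m := by
  obtain ⟨C₁, h1, hC1⟩ := exists_norm_qPoch_le q hq
  obtain ⟨C₂, h2, hC2⟩ := exists_norm_qPoch_le (-q) hq
  obtain ⟨C₃, h3, hC3⟩ := exists_norm_inv_qPoch_self_le hq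
  have hb : ∀ a b c d, ‖qPoch q q a * qPoch (-q) q b / (qPoch q q c * qPoch q q d)‖ ≤
      C₁ * C₂ * (C₃ * C₃) := by
    intro a b c d
    rw [div_eq_mul_inv, mul_inv, norm_mul, norm_mul, norm_mul]
    have := hC1 a; have := hC2 b; have := hC3 c; have := hC3 d
    gcongr
  refine ⟨C₁ * C₂ * (C₃ * C₃), ?_, fun s d m => hb _ _ _ _, fun s d m => ?_⟩
  · exact one_le_mul_of_one_le_of_one_le (one_le_mul_of_one_le_of_one_le h1 h2)
      (one_le_mul_of_one_le_of_one_le h3 h3)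
  have e : qGaussCoeff q s d (m + 1) - qGaussCoeff q s d m =
      qPoch q q (m + s) * qPoch (-q) q (m + s) / (qPoch q q (m + 1) * qPoch q q (m + d + 1)) *
        (q ^ m * (q + q ^ (d + 1) - q ^ (m + 2 * s + 2) - q ^ (m + d + 2))) := by
    rw [qGaussCoeff, qGaussCoeff, show m + 1 + s = m + s + 1 by ring, qPoch_mul_qPoch_neg_succ,
      show m + 1 + d = m + d + 1 by ring, qPoch_self_succ q m, qPoch_self_succ q (m + d)]
    have := qPoch_self_ne_zero hq m; have := qPoch_self_ne_zero hq (m + d)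
    have := one_sub_pow_succ_ne_zero hq m; have := one_sub_pow_succ_ne_zero hq (m + d)
    field_simp
    ring
  have hp : ∀ n, ‖q ^ n‖ ≤ 1 := fun n => by
    rw [norm_pow]; exact pow_le_one₀ (norm_nonneg q) hq.le
  rw [e, norm_mul, norm_mul, norm_pow]
  have h4 : ‖q + q ^ (d + 1) - q ^ (m + 2 * s + 2) - q ^ (m + d + 2)‖ ≤ 4 := by
    refine (norm_sub_le _ _).trans ?_
    have := norm_sub_le (q + q ^ (d + 1)) (q ^ (m + 2 * s + 2))
    have := norm_add_le q (q ^ (d + 1))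
    have := hp (d + 1); have := hp (m + 2 * s + 2); have := hp (m + d + 2)
    linarith
  calc _ ≤ C₁ * C₂ * (C₃ * C₃) * (‖q‖ ^ m * 4) := by
        gcongr
        exact hb _ _ _ _
    _ = _ := by ring

theorem exists_norm_qGaussSum_le {q : ℂ} (hq : ‖q‖ < 1) :
    ∃ C : ℝ, ∀ s d x, 0 ≤ x → x < 1 → ‖qGaussSum q s d x‖ ≤ C := by
  obtain ⟨C, -, hC, hd⟩ := exists_norm_qGaussCoeff_le hq
  exact ⟨_, fun s d x h0 h1 =>
    norm_tsum_neg_pow_mul_le (norm_nonneg q) hq (hC s d) (hd s d) h0 h1⟩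

theorem summable_qGaussSum {q : ℂ} (hq : ‖q‖ < 1) (s d : ℕ) {x : ℝ} (h0 : 0 ≤ x) (h1 : x < 1) :
    Summable fun m : ℕ => (-(x : ℂ)) ^ m * qGaussCoeff q s d m := by
  obtain ⟨C, -, hC, -⟩ := exists_norm_qGaussCoeff_le hq
  exact summable_neg_pow_mul (hC s d) h0 h1

theorem qGaussSum_eq_add {q : ℂ} (hq : ‖q‖ < 1) (s d : ℕ) {x : ℝ} (h0 : 0 ≤ x) (h1 : x < 1) :
    qGaussSum q s d x = qGaussCoeff q s d 0 -
      x * ∑' m : ℕ, (-(x : ℂ)) ^ m * qGaussCoeff q s d (m + 1) := by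
  rw [qGaussSum, (summable_qGaussSum hq s d h0 h1).tsum_eq_zero_add, ← tsum_mul_left, sub_eq_add_neg,
    ← tsum_neg, pow_zero, one_mul]
  congr 1
  exact tsum_congr fun m => by ring

theorem summable_qGaussSum_succ {q : ℂ} (hq : ‖q‖ < 1) (s d : ℕ) {x : ℝ} (h0 : 0 ≤ x)
    (h1 : x < 1) : Summable fun m : ℕ => (-(x : ℂ)) ^ m * qGaussCoeff q s d (m + 1) := by
  obtain ⟨C, -, hC, -⟩ := exists_norm_qGaussCoeff_le hq
  exact summable_neg_pow_mul (fun m => hC s d (m + 1)) h0 h1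

/-- A contiguous relation whose right side dies as `x → 1`, so the Abel limit does not depend on
`r`. -/
theorem qGaussSum_recurrence {q : ℂ} (hq : ‖q‖ < 1) (r : ℕ) {x : ℝ} (h0 : 0 ≤ x) (h1 : x < 1) :
    qGaussSum q r (2 * r + 1) x - x * qGaussSum q (r + 1) (2 * r + 3) x =
      (1 - x) * qGaussSum q (r + 1) (2 * r + 2) x := by
  have hT := qGaussSum_eq_add hq (r + 1) (2 * r + 2) h0 h1
  have hz : qGaussCoeff q r (2 * r + 1) 0 = qGaussCoeff q (r + 1) (2 * r + 2) 0 := by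
    simp only [qGaussCoeff, zero_add, qPoch_zero, one_mul]
    rw [qPoch_mul_qPoch_neg_succ, qPoch_self_succ q (2 * r + 1)]
    have := qPoch_self_ne_zero hq (2 * r + 1); have := one_sub_pow_succ_ne_zero hq (2 * r + 1)
    rw [show 2 * (r + 1) = 2 * r + 1 + 1 by ring]
    field_simp
  have hS : ∑' m : ℕ, (-(x : ℂ)) ^ m * qGaussCoeff q r (2 * r + 1) (m + 1) +
      qGaussSum q (r + 1) (2 * r + 3) x =
      ∑' m : ℕ, (-(x : ℂ)) ^ m * qGaussCoeff q (r + 1) (2 * r + 2) (m + 1) +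
      qGaussSum q (r + 1) (2 * r + 2) x := by
    rw [qGaussSum, qGaussSum, ← (summable_qGaussSum_succ hq _ _ h0 h1).tsum_add
      (summable_qGaussSum hq _ _ h0 h1), ← (summable_qGaussSum_succ hq _ _ h0 h1).tsum_add
      (summable_qGaussSum hq _ _ h0 h1)]
    refine tsum_congr fun m => ?_
    rw [← mul_add, ← mul_add]
    congr 1
    simp only [qGaussCoeff]
    rw [show m + 1 + (r + 1) = m + (r + 1) + 1 by ring, qPoch_mul_qPoch_neg_succ,
      show m + 1 + r = m + (r + 1) by ring,
      show m + 1 + (2 * r + 1) = m + (2 * r + 2) by ring,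
      show m + 1 + (2 * r + 2) = m + (2 * r + 2) + 1 by ring,
      show m + (2 * r + 3) = m + (2 * r + 2) + 1 by ring,
      qPoch_self_succ q m, qPoch_self_succ q (m + (2 * r + 2))]
    have := qPoch_self_ne_zero hq m; have := qPoch_self_ne_zero hq (m + (2 * r + 2))
    have := one_sub_pow_succ_ne_zero hq m; have := one_sub_pow_succ_ne_zero hq (m + (2 * r + 2))
    field_simp
    ring
  rw [qGaussSum_eq_add hq r (2 * r + 1) h0 h1, hz]
  linear_combination (-(x : ℂ)) * hS - hT

/-- Source of the value `1/2`: with `c_m = qGaussCoeff q 0 0 m`, twice the coefficient on the left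
is `c_m + c_{m+1}`, so the alternating sum telescopes up to a factor `1 - x`. -/
theorem qGaussSum_zero_one {q : ℂ} (hq : ‖q‖ < 1) {x : ℝ} (h0 : 0 ≤ x) (h1 : x < 1) :
    2 * x * qGaussSum q 0 1 x = 1 - (1 - x) * qGaussSum q 0 0 x := by
  have hT := qGaussSum_eq_add hq 0 0 h0 h1
  have hS : 2 * qGaussSum q 0 1 x =
      ∑' m : ℕ, (-(x : ℂ)) ^ m * qGaussCoeff q 0 0 (m + 1) + qGaussSum q 0 0 x := by
    rw [qGaussSum, qGaussSum, ← (summable_qGaussSum_succ hq _ _ h0 h1).tsum_add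
      (summable_qGaussSum hq _ _ h0 h1), ← tsum_mul_left]
    refine tsum_congr fun m => ?_
    rw [← mul_add, mul_left_comm]
    congr 1
    simp only [qGaussCoeff, add_zero]
    rw [qPoch_mul_qPoch_neg_succ, qPoch_self_succ q m]
    have := qPoch_self_ne_zero hq m
    have := one_sub_pow_succ_ne_zero hq m
    field_simp
    ring
  have hz : qGaussCoeff q 0 0 0 = 1 := by simp [qGaussCoeff, qPoch_zero]
  rw [hz] at hT
  linear_combination (x : ℂ) * hS + hT

theorem eventually_mem_Ico : ∀ᶠ x : ℝ in 𝓝[<] 1, 0 ≤ x ∧ x < 1 := by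
  filter_upwards [Ioo_mem_nhdsLT (zero_lt_one (α := ℝ))] with x hx
  exact ⟨hx.1.le, hx.2⟩

theorem tendsto_ofReal_nhdsLT_one : Tendsto (fun x : ℝ => (x : ℂ)) (𝓝[<] 1) (𝓝 1) := by
  have : Tendsto (fun x : ℝ => (x : ℂ)) (𝓝 1) (𝓝 ((1 : ℝ) : ℂ)) := Complex.continuous_ofReal.tendsto 1
  simpa using this.mono_left nhdsWithin_le_nhds

theorem tendsto_one_sub_mul_qGaussSum {q : ℂ} (hq : ‖q‖ < 1) (s d : ℕ) :
    Tendsto (fun x : ℝ => (1 - (x : ℂ)) * qGaussSum q s d x) (𝓝[<] 1) (𝓝 0) := by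
  obtain ⟨C, hC⟩ := exists_norm_qGaussSum_le hq
  have h : Tendsto (fun x : ℝ => ‖1 - (x : ℂ)‖ * C) (𝓝[<] 1) (𝓝 0) := by
    simpa using (tendsto_ofReal_nhdsLT_one.const_sub 1).norm.mul_const C
  refine squeeze_zero_norm' ?_ h
  filter_upwards [eventually_mem_Ico] with x hx
  rw [norm_mul]
  exact mul_le_mul_of_nonneg_left (hC s d x hx.1 hx.2) (norm_nonneg _)

/-- The boundary case of the `q`-Gauss sum, as an Abel sum. -/
theorem tendsto_qGaussSum {q : ℂ} (hq : ‖q‖ < 1) (r : ℕ) :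
    Tendsto (qGaussSum q r (2 * r + 1)) (𝓝[<] 1) (𝓝 (1 / 2)) := by
  have hx := tendsto_ofReal_nhdsLT_one
  have hpos : ∀ᶠ x : ℝ in 𝓝[<] 1, 0 < x := by
    filter_upwards [Ioo_mem_nhdsLT (zero_lt_one (α := ℝ))] with x hx using hx.1
  induction r with
  | zero =>
    have h : Tendsto (fun x : ℝ => (1 - (1 - (x : ℂ)) * qGaussSum q 0 0 x) / (2 * x)) (𝓝[<] 1)
        (𝓝 ((1 - 0) / (2 * 1))) :=
      ((tendsto_one_sub_mul_qGaussSum hq 0 0).const_sub 1).div (hx.const_mul 2) (by norm_num)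
    refine (h.congr' ?_).trans (le_of_eq (by norm_num))
    filter_upwards [eventually_mem_Ico, hpos] with x hx hp
    have : (x : ℂ) ≠ 0 := by exact_mod_cast hp.ne'
    rw [← qGaussSum_zero_one hq hx.1 hx.2]
    field_simp
  | succ r ih =>
    have h : Tendsto (fun x : ℝ => (qGaussSum q r (2 * r + 1) x -
        (1 - (x : ℂ)) * qGaussSum q (r + 1) (2 * r + 2) x) / x) (𝓝[<] 1)
        (𝓝 ((1 / 2 - 0) / 1)) :=
      (ih.sub (tendsto_one_sub_mul_qGaussSum hq _ _)).div hx one_ne_zero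
    refine (h.congr' ?_).trans (le_of_eq (by norm_num))
    filter_upwards [eventually_mem_Ico, hpos] with x hx hp
    have : (x : ℂ) ≠ 0 := by exact_mod_cast hp.ne'
    rw [← qGaussSum_recurrence hq r hx.1 hx.2, show 2 * (r + 1) + 1 = 2 * r + 3 by ring]
    field_simp
    ring

/-! ### Abel summation against a Bailey pair. -/

theorem tsum_sum_antidiagonal {f : ℕ × ℕ → ℂ} (hf : Summable f) :
    ∑' N, ∑ p ∈ antidiagonal N, f p = ∑' n, ∑' m, f (m, n) := by
  have hs : Summable fun y : (Σ N : ℕ, antidiagonal N) => f y.2 :=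
    (Finset.HasAntidiagonal.sigmaAntidiagonalEquivProd (A := ℕ)).summable_iff.mpr hf
  calc _ = ∑' y : (Σ N : ℕ, antidiagonal N), f y.2 := by
        rw [hs.tsum_sigma' fun N => (hasSum_fintype _).summable]
        exact tsum_congr fun N => by rw [Finset.tsum_subtype (antidiagonal N) f]
    _ = ∑' p, f p := (Finset.HasAntidiagonal.sigmaAntidiagonalEquivProd (A := ℕ)).tsum_eq f
    _ = ∑' p : ℕ × ℕ, f p.swap := ((Equiv.prodComm ℕ ℕ).tsum_eq f).symm
    _ = _ := ((Equiv.prodComm ℕ ℕ).summable_iff.mpr hf).tsum_prod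

/-- With `N = m + n`, the index `N + n + 2r + 1` is `m + (2(n+r) + 1)`, so the sum over `m` stays in
the family whose Abel limit is known. -/
theorem tsum_baileyBeta {q : ℂ} (hq : ‖q‖ < 1) {α : ℕ → ℂ} (hα : Summable fun n => ‖α n‖)
    (r : ℕ) {x : ℝ} (h0 : 0 ≤ x) (h1 : x < 1) :
    ∑' N, (-(x : ℂ)) ^ N * (qPoch q q (N + r) * qPoch (-q) q (N + r) *
        baileyBeta q (2 * r + 1) α N) =
      ∑' n, (-(x : ℂ)) ^ n * α n * qGaussSum q (n + r) (2 * (n + r) + 1) x := by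
  obtain ⟨C, -, hC, -⟩ := exists_norm_qGaussCoeff_le hq
  have hs : Summable fun p : ℕ × ℕ => (-(x : ℂ)) ^ (p.1 + p.2) * α p.2 *
      qGaussCoeff q (p.2 + r) (2 * (p.2 + r) + 1) p.1 := by
    have hb := ((summable_geometric_of_lt_one h0 h1).mul_of_nonneg hα
      (fun m => pow_nonneg h0 m) (fun n => norm_nonneg _)).mul_right C
    refine Summable.of_norm_bounded hb fun p => ?_
    rw [norm_mul, norm_mul, norm_pow, norm_neg, Complex.norm_real, Real.norm_of_nonneg h0, pow_add,
      mul_assoc (x ^ p.1)]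
    have : x ^ p.2 * ‖α p.2‖ ≤ ‖α p.2‖ :=
      mul_le_of_le_one_left (norm_nonneg _) (pow_le_one₀ h0 h1.le)
    have := hC (p.2 + r) (2 * (p.2 + r) + 1) p.1
    gcongr
  refine Eq.trans ?_ ((tsum_sum_antidiagonal hs).trans ?_)
  · refine tsum_congr fun N => ?_
    rw [baileyBeta, Finset.mul_sum, Finset.mul_sum]
    refine Finset.sum_congr rfl fun p hp => ?_
    obtain ⟨m, n⟩ := p
    have hN : m + n = N := mem_antidiagonal.mp hp
    subst hN
    simp only [qGaussCoeff]
    rw [show m + n + n + (2 * r + 1) = m + (2 * (n + r) + 1) by ring, add_assoc m n r]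
    ring
  · refine tsum_congr fun n => ?_
    rw [qGaussSum, ← tsum_mul_left]
    exact tsum_congr fun m => by simp only []; ring

theorem tendsto_tsum_baileyBeta {q : ℂ} (hq : ‖q‖ < 1) {α : ℕ → ℂ}
    (hα : Summable fun n => ‖α n‖) (r : ℕ) :
    Tendsto (fun x : ℝ => ∑' N, (-(x : ℂ)) ^ N * (qPoch q q (N + r) * qPoch (-q) q (N + r) *
        baileyBeta q (2 * r + 1) α N)) (𝓝[<] 1) (𝓝 (∑' n, (-1) ^ n * α n * (1 / 2))) := by
  obtain ⟨C, hC⟩ := exists_norm_qGaussSum_le hq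
  have h : Tendsto (fun x : ℝ =>
      ∑' n, (-(x : ℂ)) ^ n * α n * qGaussSum q (n + r) (2 * (n + r) + 1) x)
      (𝓝[<] 1) (𝓝 (∑' n, (-1) ^ n * α n * (1 / 2))) := by
    refine tendsto_tsum_of_dominated_convergence (hα.mul_right C) (fun n => ?_) ?_
    · exact ((tendsto_ofReal_nhdsLT_one.neg.pow n).mul_const _).mul (tendsto_qGaussSum hq (n + r))
    · filter_upwards [eventually_mem_Ico] with x hx n
      rw [norm_mul, norm_mul, norm_pow, norm_neg, Complex.norm_real, Real.norm_of_nonneg hx.1]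
      have : x ^ n * ‖α n‖ ≤ ‖α n‖ :=
        mul_le_of_le_one_left (norm_nonneg _) (pow_le_one₀ hx.1 hx.2.le)
      have := hC (n + r) (2 * (n + r) + 1) x hx.1 hx.2
      gcongr
  refine h.congr' ?_
  filter_upwards [eventually_mem_Ico] with x hx
  rw [tsum_baileyBeta hq hα r hx.1 hx.2]

/-! ### The multisum as a Bailey chain. -/

theorem sum_antidiagonalTuple_succ (k N : ℕ) (f : (Fin (k + 1) → ℕ) → ℂ) :
    ∑ n ∈ antidiagonalTuple (k + 1) N, f n =
      ∑ p ∈ antidiagonal N, ∑ n ∈ antidiagonalTuple k p.2, f (Fin.cons p.1 n) := by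
  rw [Finset.sum_sigma']
  refine Finset.sum_nbij' (fun n => ⟨(n 0, ∑ j, Fin.tail n j), Fin.tail n⟩)
    (fun y => Fin.cons y.1.1 y.2) ?_ ?_ ?_ ?_ ?_
  · intro n hn
    rw [mem_antidiagonalTuple, Fin.sum_univ_succ] at hn
    simp only [Finset.mem_sigma, mem_antidiagonal, mem_antidiagonalTuple, and_true]
    exact hn
  · rintro ⟨⟨a, b⟩, n⟩ h
    simp only [Finset.mem_sigma, mem_antidiagonal, mem_antidiagonalTuple] at h
    rw [mem_antidiagonalTuple, Fin.sum_univ_succ]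
    simpa [h.2] using h.1
  · intro n _
    exact Fin.cons_self_tail n
  · rintro ⟨⟨a, b⟩, n⟩ h
    simp only [Finset.mem_sigma, mem_antidiagonal, mem_antidiagonalTuple] at h
    obtain ⟨-, rfl⟩ := h
    simp
  · intro n _
    simp

theorem tailSum_one {k : ℕ} (n : Fin k → ℕ) : tailSum n 1 = ∑ r, n r := by
  simp [tailSum]

theorem tailSum_cons {k : ℕ} (a : ℕ) (n : Fin k → ℕ) (j : ℕ) :
    tailSum (Fin.cons a n : Fin (k + 1) → ℕ) (j + 2) = tailSum n (j + 1) := by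
  simp [tailSum, Fin.sum_univ_succ]

/-- The part of the summand that depends on more than `N_1`, with weights
`q^(N_j² + ε_j N_j)` for `2 ≤ j`. -/
noncomputable def chainTerm (q : ℂ) (e : ℕ) (ε : ℕ → ℕ) (k : ℕ) (n : Fin (k + 1) → ℕ) : ℂ :=
  (∏ j ∈ Finset.range k, q ^ (tailSum n (j + 2) ^ 2 + ε j * tailSum n (j + 2))) /
    ((∏ r, qPoch q q (n r)) * qPoch q q (tailSum n (k + 1) + e))

/-- Removing `n_1` leaves a tuple whose `N_1` is the former `N_2`, which matches the recursion of
`chainSum`. -/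
theorem sum_chainTerm (q : ℂ) (e : ℕ) (ε : ℕ → ℕ) (k N : ℕ) :
    ∑ n ∈ antidiagonalTuple (k + 1) N, chainTerm q e ε k n = chainSum q e ε k N := by
  induction k generalizing ε N with
  | zero =>
    rw [show antidiagonalTuple (0 + 1) N = {![N]} from Finset.Nat.antidiagonalTuple_one N,
      Finset.sum_singleton]
    simp [chainTerm, chainSum, tailSum]
  | succ k ih =>
    rw [sum_antidiagonalTuple_succ, chainSum]
    refine Finset.sum_congr rfl fun p _ => ?_
    rw [← ih, Finset.mul_sum]
    refine Finset.sum_congr rfl fun n hn => ?_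
    rw [mem_antidiagonalTuple] at hn
    rw [chainTerm, chainTerm, Finset.prod_range_succ', Fin.prod_univ_succ]
    simp only [tailSum_cons, Fin.cons_zero, Fin.cons_succ, zero_add, tailSum_one, hn]
    ring

/-- The linear coefficient of `N_j` is `2ℓ - 1` for `2 ≤ j ≤ i` and `2ℓ` for `j > i`. The exponent
is thus a natural number, and the integer power becomes an ordinary one. -/
theorem evenExponent_eq (m κ r : ℕ) (n : Fin (m + κ + 1) → ℕ) :
    evenExponent (m + κ + 1) (m + 1) (r + 1) n =
      ((∑ j ∈ Finset.range (m + κ), (tailSum n (j + 2) ^ 2 +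
        (if j < m then 2 * r + 1 else 2 * r + 1 + 1) * tailSum n (j + 2)) : ℕ) : ℤ) := by
  have hI : ∀ (s : ℕ) (f : ℕ → ℤ),
      ∑ j ∈ Finset.Icc 2 (s + 1), f j = ∑ j ∈ Finset.range s, f (j + 2) := by
    intro s f
    rw [Finset.range_eq_Ico, Finset.sum_Ico_add' f 0 s 2]
    congr 1
  have hm : ∑ j ∈ Finset.range m, (tailSum n (j + 2) : ℤ) =
      ∑ j ∈ Finset.range (m + κ), if j < m then (tailSum n (j + 2) : ℤ) else 0 := by
    rw [← Finset.sum_filter]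
    congr 1
    ext j
    simp only [Finset.mem_range, Finset.mem_filter]
    omega
  rw [evenExponent, hI, hI, hI, hm, Finset.mul_sum, ← Finset.sum_add_distrib,
    ← Finset.sum_sub_distrib]
  push_cast
  refine Finset.sum_congr rfl fun j _ => ?_
  split_ifs <;> ring

theorem evenTerm_eq (m κ r : ℕ) (q : ℂ) (n : Fin (m + κ + 1) → ℕ) :
    evenTerm (m + κ + 1) (m + 1) (r + 1) q n =
      (-1) ^ tailSum n 1 * (qPoch q q (tailSum n 1 + r) * qPoch (-q) q (tailSum n 1 + r)) *
        chainTerm q (2 * r + 1) (fun j => if j < m then 2 * r + 1 else 2 * r + 1 + 1) (m + κ) n := by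
  rw [evenTerm, evenExponent_eq, zpow_natCast, chainTerm, Finset.prod_pow_eq_pow_sum,
    show tailSum n 1 + (r + 1) - 1 = tailSum n 1 + r by omega,
    show tailSum n (m + κ + 1) + 2 * (r + 1) - 1 = tailSum n (m + κ + 1) + (2 * r + 1) by omega,
    mul_div_assoc]

theorem summable_pow_tailSum (k : ℕ) {x : ℝ} (h0 : 0 ≤ x) (h1 : x < 1) :
    Summable fun n : Fin k → ℕ => x ^ tailSum n 1 := by
  simp only [tailSum_one, ← Finset.prod_pow_eq_pow_sum]
  induction k with
  | zero => exact (hasSum_fintype _).summable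
  | succ k ih =>
    rw [← (Fin.consEquiv fun _ => ℕ).summable_iff]
    have := (summable_geometric_of_lt_one h0 h1).mul_of_nonneg ih
      (fun m => pow_nonneg h0 m) (fun n => Finset.prod_nonneg fun i _ => pow_nonneg h0 _)
    refine this.congr fun p => ?_
    simp [Fin.consEquiv, Fin.prod_univ_succ]

theorem exists_norm_chainTerm_le {q : ℂ} (hq : ‖q‖ < 1) (e : ℕ) (ε : ℕ → ℕ) (k : ℕ) :
    ∃ C : ℝ, 0 ≤ C ∧ ∀ n, ‖chainTerm q e ε k n‖ ≤ C := by
  obtain ⟨C, h1, hC⟩ := exists_norm_inv_qPoch_self_le hq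
  refine ⟨C ^ (k + 1) * C, by positivity, fun n => ?_⟩
  rw [chainTerm, div_eq_mul_inv, mul_inv, norm_mul, norm_mul, ← Finset.prod_inv_distrib, norm_prod,
    norm_prod]
  have ha : ∏ j ∈ Finset.range k, ‖q ^ (tailSum n (j + 2) ^ 2 + ε j * tailSum n (j + 2))‖ ≤ 1 :=
    Finset.prod_le_one (fun j _ => norm_nonneg _) fun j _ => by
      rw [norm_pow]; exact pow_le_one₀ (norm_nonneg q) hq.le
  have hb : ∏ r, ‖(qPoch q q (n r))⁻¹‖ ≤ C ^ (k + 1) := by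
    refine (Finset.prod_le_prod (fun r _ => norm_nonneg _) fun r _ => hC (n r)).trans (by simp)
  calc _ ≤ 1 * (C ^ (k + 1) * C) := by
        have := hC (tailSum n (k + 1) + e)
        gcongr
    _ = _ := one_mul _

theorem hasAbelMultisum_evenTerm {q : ℂ} (hq : ‖q‖ < 1) (m κ r : ℕ)
    (hα : Summable fun n => ‖chainCoeff q (2 * r + 1) (m + 1) κ n‖) :
    HasAbelMultisum (evenTerm (m + κ + 1) (m + 1) (r + 1) q)
      (∑' n, (-1) ^ n * chainCoeff q (2 * r + 1) (m + 1) κ n * (1 / 2)) := by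
  have hs : ∀ x : ℝ, 0 ≤ x → x < 1 → Summable fun n : Fin (m + κ + 1) → ℕ =>
      (x : ℂ) ^ tailSum n 1 * evenTerm (m + κ + 1) (m + 1) (r + 1) q n := by
    intro x h0 h1
    obtain ⟨C₁, h1', hC1⟩ := exists_norm_qPoch_le q hq
    obtain ⟨C₂, h2', hC2⟩ := exists_norm_qPoch_le (-q) hq
    obtain ⟨C, h3', hC⟩ := exists_norm_chainTerm_le hq (2 * r + 1)
      (fun j => if j < m then 2 * r + 1 else 2 * r + 1 + 1) (m + κ)
    refine Summable.of_norm_bounded ((summable_pow_tailSum _ h0 h1).mul_right (C₁ * C₂ * C))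
      fun n => ?_
    rw [evenTerm_eq, norm_mul, norm_mul, norm_mul, norm_mul, norm_pow, norm_pow, norm_neg,
      norm_one, one_pow, one_mul, Complex.norm_real, Real.norm_of_nonneg h0]
    have := hC1 (tailSum n 1 + r); have := hC2 (tailSum n 1 + r); have := hC n
    gcongr
  refine ⟨hs, ?_⟩
  refine (tendsto_tsum_baileyBeta hq hα r).congr' ?_
  filter_upwards [eventually_mem_Ico] with x hx
  have hs' := (Finset.Nat.sigmaAntidiagonalTupleEquivTuple (m + κ + 1)).summable_iff.mpr
    (hs x hx.1 hx.2)
  rw [← (Finset.Nat.sigmaAntidiagonalTupleEquivTuple (m + κ + 1)).tsum_eq]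
  refine Eq.trans ?_ (hs'.tsum_sigma' fun N => (hasSum_fintype _).summable).symm
  refine tsum_congr fun N => ?_
  refine Eq.trans ?_ (Finset.tsum_subtype (antidiagonalTuple (m + κ + 1) N) fun n =>
    (x : ℂ) ^ tailSum n 1 * evenTerm (m + κ + 1) (m + 1) (r + 1) q n).symm
  rw [← chainSum_eq_baileyBeta hq, ← sum_chainTerm, Finset.mul_sum, Finset.mul_sum]
  refine Finset.sum_congr rfl fun n hn => ?_
  rw [mem_antidiagonalTuple] at hn
  rw [evenTerm_eq, tailSum_one, hn, neg_pow]
  ring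

/-! ### The Jacobi triple product, from its finite form. -/

theorem two_mul_choose_two_add (s : ℕ) : 2 * s.choose 2 + s = s ^ 2 := by
  induction s with
  | zero => rfl
  | succ s ih => rw [Nat.choose_succ_succ' s 1, Nat.choose_one_right]; linarith

/-- The coefficient `(-1)^s p^(s(s-1)/2) a^s` for `s = j - m ≥ 0`, and
`(-1)^s p^(s(s-1)/2) b^s` for `s = m - j > 0`. -/
noncomputable def thetaCoeff (p a b : ℂ) (m j : ℕ) : ℂ :=
  if m ≤ j then (-1) ^ (j - m) * p ^ (j - m).choose 2 * a ^ (j - m)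
  else (-1) ^ (m - j) * p ^ (m - j).choose 2 * b ^ (m - j)

/-- The ratio of consecutive theta terms is `-a p^(j-m)`; the factor `p^(m+n-j)` clears its possibly
negative power. -/
theorem thetaCoeff_succ {p a b : ℂ} (hab : a * b = p) {m n j : ℕ} (hj : j ≤ m + n) :
    thetaCoeff p a b m (j + 1) * p ^ (m + n - j) = -(a * p ^ n * thetaCoeff p a b m j) := by
  rcases le_or_gt m j with h | h
  · obtain ⟨s, rfl⟩ := Nat.exists_eq_add_of_le h
    rw [thetaCoeff, thetaCoeff, if_pos (by omega), if_pos h, add_assoc,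
      Nat.add_sub_cancel_left, Nat.add_sub_cancel_left, Nat.choose_succ_succ' s 1,
      Nat.choose_one_right]
    obtain ⟨t, ht⟩ := Nat.exists_eq_add_of_le (show s ≤ n by omega)
    rw [show m + n - (m + s) = t by omega, ht]
    ring
  · obtain ⟨s, rfl⟩ := Nat.exists_eq_add_of_lt h
    -- For `s = 0` the index `j + 1` is the centre, where the other branch of `thetaCoeff` applies.
    have e : thetaCoeff p a b (j + s + 1) (j + 1) = (-1) ^ s * p ^ s.choose 2 * b ^ s := by
      rcases Nat.eq_zero_or_pos s with rfl | hs
      · simp [thetaCoeff]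
      · rw [thetaCoeff, if_neg (by omega), show j + s + 1 - (j + 1) = s by omega]
    rw [e, thetaCoeff, if_neg (by omega), show j + s + 1 - j = s + 1 by omega,
      Nat.choose_succ_succ' s 1, Nat.choose_one_right,
      show j + s + 1 + n - j = s + n + 1 by omega, pow_succ b, pow_succ p (s + n)]
    -- The isolated factor `p` becomes `a * b` and supplies the `a` and the extra `b` on the right.
    nth_rewrite 3 [← hab]
    ring

theorem thetaCoeff_symm (p a b : ℂ) {m n i j : ℕ} (h : i + j = m + n) :
    thetaCoeff p a b m j = thetaCoeff p b a n i := by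
  rcases lt_trichotomy m j with h' | h' | h'
  · rw [thetaCoeff, thetaCoeff, if_pos h'.le, if_neg (by omega), show n - i = j - m by omega]
  · obtain rfl : i = n := by omega
    simp [thetaCoeff, h']
  · rw [thetaCoeff, thetaCoeff, if_neg (by omega), if_pos (by omega), show i - n = m - j by omega]

/-- Splitting `1 - p^(i+j) = (1 - p^i) + p^i (1 - p^j)` brings in only the ratio `t (j+1) / t j`, so
each use extracts one factor of a finite product. -/
theorem sum_antidiagonal_succ_qBinomial {p : ℂ} (hp : ‖p‖ < 1) {t : ℕ → ℂ} {c : ℂ} {N : ℕ}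
    (ht : ∀ j ≤ N, t (j + 1) * p ^ (N - j) = -(c * t j)) :
    (1 - p ^ (N + 1)) * ∑ y ∈ antidiagonal (N + 1), t y.2 / (qPoch p p y.1 * qPoch p p y.2) =
      (1 - c) * ∑ y ∈ antidiagonal N, t y.2 / (qPoch p p y.1 * qPoch p p y.2) := by
  have e : (1 - p ^ (N + 1)) *
      ∑ y ∈ antidiagonal (N + 1), t y.2 / (qPoch p p y.1 * qPoch p p y.2) =
      ∑ y ∈ antidiagonal (N + 1), t y.2 / (qPoch p p y.1 * qPoch p p y.2) * (1 - p ^ y.1) +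
      ∑ y ∈ antidiagonal (N + 1),
        t y.2 / (qPoch p p y.1 * qPoch p p y.2) * (p ^ y.1 * (1 - p ^ y.2)) := by
    rw [Finset.mul_sum, ← Finset.sum_add_distrib]
    refine Finset.sum_congr rfl fun y hy => ?_
    rw [← mem_antidiagonal.mp hy, pow_add]
    ring
  rw [e, Finset.Nat.sum_antidiagonal_succ, Finset.Nat.sum_antidiagonal_succ']
  simp only [pow_zero, sub_self, mul_zero, zero_add]
  rw [← Finset.sum_add_distrib, Finset.mul_sum]
  refine Finset.sum_congr rfl fun y hy => ?_
  obtain ⟨i, j⟩ := y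
  have hN : i + j = N := mem_antidiagonal.mp hy
  have h := ht j (by omega)
  rw [show N - j = i by omega] at h
  simp only
  rw [qPoch_self_succ, qPoch_self_succ]
  have := qPoch_self_ne_zero hp i; have := qPoch_self_ne_zero hp j
  have := one_sub_pow_succ_ne_zero hp i; have := one_sub_pow_succ_ne_zero hp j
  field_simp
  linear_combination h

/-- The finite form of the Jacobi triple product identity. -/
theorem sum_thetaCoeff {p a b : ℂ} (hp : ‖p‖ < 1) (hab : a * b = p) (m n : ℕ) :
    qPoch p p (m + n) * ∑ y ∈ antidiagonal (m + n),
      thetaCoeff p a b m y.2 / (qPoch p p y.1 * qPoch p p y.2) = qPoch a p n * qPoch b p m := by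
  have step : ∀ (a b : ℂ) (m n : ℕ), a * b = p →
      qPoch p p (m + n) * ∑ y ∈ antidiagonal (m + n),
        thetaCoeff p a b m y.2 / (qPoch p p y.1 * qPoch p p y.2) = qPoch a p n * qPoch b p m →
      qPoch p p (m + (n + 1)) * ∑ y ∈ antidiagonal (m + (n + 1)),
        thetaCoeff p a b m y.2 / (qPoch p p y.1 * qPoch p p y.2) =
        qPoch a p (n + 1) * qPoch b p m := by
    intro a b m n hab h
    have hs := sum_antidiagonal_succ_qBinomial hp (t := thetaCoeff p a b m) (c := a * p ^ n)
      (N := m + n) fun j hj => thetaCoeff_succ hab hj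
    rw [← add_assoc, qPoch_self_succ, mul_assoc, hs, qPoch_succ]
    linear_combination (1 - a * p ^ n) * h
  have base : ∀ (a b : ℂ) (n : ℕ), a * b = p →
      qPoch p p (0 + n) * ∑ y ∈ antidiagonal (0 + n),
        thetaCoeff p a b 0 y.2 / (qPoch p p y.1 * qPoch p p y.2) = qPoch a p n * qPoch b p 0 := by
    intro a b n hab
    induction n with
    | zero => simp [qPoch_zero, thetaCoeff]
    | succ n ih => exact step a b 0 n hab ih
  induction n with
  | succ n ih => exact step a b m n hab ih
  | zero =>
    -- For `n = 0`, reflecting the antidiagonal exchanges `a` with `b` and reduces to the base case.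
    have h := base b a m (by rw [mul_comm, hab])
    rw [zero_add] at h
    rw [mul_comm (qPoch a p 0), add_zero, ← h, ← Finset.Nat.sum_antidiagonal_swap]
    congr 1
    refine Finset.sum_congr rfl fun y hy => ?_
    rw [Prod.fst_swap, Prod.snd_swap, mul_comm (qPoch p p y.2),
      thetaCoeff_symm p a b (n := 0) (show y.2 + y.1 = m + 0 by
        rw [add_comm, mem_antidiagonal.mp hy, add_zero])]

/-- The sum of the terms of index `s` and `-s` of the theta series. -/
noncomputable def thetaPair (p a b : ℂ) : ℕ → ℂ
  | 0 => 1
  | s + 1 => (-1) ^ (s + 1) * p ^ (s + 1).choose 2 * (a ^ (s + 1) + b ^ (s + 1))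

theorem sum_range_add_self_succ (f : ℕ → ℂ) (M : ℕ) :
    ∑ j ∈ Finset.range (M + M).succ, f j =
      ∑ s ∈ Finset.range M, (f (M - (s + 1)) + f (M + (s + 1))) + f M := by
  rw [show (M + M).succ = M + (M + 1) by omega, Finset.sum_range_add, Finset.sum_range_succ',
    ← Finset.sum_range_reflect f M, ← add_assoc, ← Finset.sum_add_distrib]
  congr 1
  refine Finset.sum_congr rfl fun s _ => ?_
  rw [show M - 1 - s = M - (s + 1) by omega]

theorem sum_thetaPair {p a b : ℂ} (hp : ‖p‖ < 1) (hab : a * b = p) (M : ℕ) :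
    ∑ s ∈ Finset.range (M + 1), thetaPair p a b s / (qPoch p p (M - s) * qPoch p p (M + s)) =
      qPoch a p M * qPoch b p M / qPoch p p (M + M) := by
  rw [eq_div_iff (qPoch_self_ne_zero hp _), mul_comm, ← sum_thetaCoeff hp hab]
  congr 1
  rw [Finset.Nat.sum_antidiagonal_eq_sum_range_succ_mk, sum_range_add_self_succ,
    Finset.sum_range_succ' (n := M)]
  congr 1
  · refine Finset.sum_congr rfl fun s hs => ?_
    have hs' := Finset.mem_range.mp hs
    simp only [thetaPair]
    rw [thetaCoeff, thetaCoeff, if_pos (by omega),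
      show M + M - (M + (s + 1)) = M - (s + 1) by omega,
      show M + M - (M - (s + 1)) = M + (s + 1) by omega, Nat.add_sub_cancel_left,
      if_neg (by omega), show M - (M - (s + 1)) = s + 1 by omega]
    ring
  · simp [thetaPair, thetaCoeff]

theorem norm_thetaPair_le {p a b : ℂ} (hp : ‖p‖ < 1) (s : ℕ) :
    ‖thetaPair p a b s‖ ≤ ‖a‖ ^ s + ‖b‖ ^ s := by
  cases s with
  | zero => simp [thetaPair]
  | succ s =>
    rw [thetaPair, norm_mul, norm_mul, norm_pow, norm_neg, norm_one, one_pow, one_mul, norm_pow]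
    refine (mul_le_of_le_one_left (norm_nonneg _) (pow_le_one₀ (norm_nonneg p) hp.le)).trans ?_
    refine (norm_add_le _ _).trans ?_
    rw [norm_pow, norm_pow]

theorem summable_norm_thetaPair {p a b : ℂ} (hp : ‖p‖ < 1) (ha : ‖a‖ < 1) (hb : ‖b‖ < 1) :
    Summable fun s => ‖thetaPair p a b s‖ :=
  Summable.of_nonneg_of_le (fun _ => norm_nonneg _) (norm_thetaPair_le hp)
    ((summable_geometric_of_lt_one (norm_nonneg a) ha).add
      (summable_geometric_of_lt_one (norm_nonneg b) hb))

/-- The Jacobi triple product identity. -/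
theorem jacobi_triple_product {p a b : ℂ} (ha : ‖a‖ < 1) (hb : ‖b‖ < 1) (hab : a * b = p) :
    ∑' s, thetaPair p a b s = qPochInf a p * qPochInf b p * qPochInf p p := by
  have hp : ‖p‖ < 1 := by
    rw [← hab, norm_mul]
    exact mul_lt_one_of_nonneg_of_lt_one_left (norm_nonneg a) ha hb.le
  obtain ⟨C, hC1, hC⟩ := exists_norm_inv_qPoch_self_le hp
  have hP := qPochInf_self_ne_zero hp
  have hlim := tendsto_qPoch p hp
  -- Let `M → ∞` in `sum_thetaPair`, by dominated convergence with bounded inverse denominators.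
  have h1 : Tendsto (fun M => ∑' s, if s ≤ M then
      thetaPair p a b s / (qPoch p p (M - s) * qPoch p p (M + s)) else 0) atTop
      (𝓝 (∑' s, thetaPair p a b s / (qPochInf p p * qPochInf p p))) := by
    refine tendsto_tsum_of_dominated_convergence
      ((summable_norm_thetaPair hp ha hb).mul_right (C * C)) (fun s => ?_) ?_
    · have h : Tendsto (fun M => thetaPair p a b s / (qPoch p p (M - s) * qPoch p p (M + s)))
          atTop (𝓝 (thetaPair p a b s / (qPochInf p p * qPochInf p p))) :=
        tendsto_const_nhds.div ((hlim.comp (tendsto_sub_atTop_nat s)).mul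
          (hlim.comp (tendsto_add_atTop_nat s))) (mul_ne_zero hP hP)
      refine h.congr' ?_
      filter_upwards [eventually_ge_atTop s] with M hM
      rw [if_pos hM]
    · filter_upwards with M s
      split_ifs
      · rw [div_eq_mul_inv, mul_inv, norm_mul, norm_mul]
        have := hC (M - s); have := hC (M + s)
        gcongr
      · rw [norm_zero]
        positivity
  have h2 : Tendsto (fun M => qPoch a p M * qPoch b p M / qPoch p p (M + M)) atTop
      (𝓝 (qPochInf a p * qPochInf b p / qPochInf p p)) :=
    ((tendsto_qPoch a hp).mul (tendsto_qPoch b hp)).div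
      (hlim.comp (tendsto_atTop_mono (fun M => Nat.le_add_left M M) tendsto_id)) hP
  have h3 := tendsto_nhds_unique (h1.congr fun M => ?_) h2
  · rw [tsum_div_const] at h3
    field_simp at h3
    linear_combination h3
  · rw [← sum_thetaPair hp hab, tsum_eq_sum (s := Finset.range (M + 1))]
    · refine Finset.sum_congr rfl fun s hs => if_pos ?_
      exact Nat.lt_succ_iff.mp (Finset.mem_range.mp hs)
    · intro s hs
      rw [Finset.mem_range] at hs
      exact if_neg (by omega)

/-! ### The theta series of the theorem and its tail. -/

theorem sum_Icc_neg_eq_sum_range (f : ℤ → ℂ) {g : ℕ → ℂ} (h0 : g 0 = f 0)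
    (hg : ∀ s : ℕ, g (s + 1) = f (s + 1) + f (-(s + 1))) (r : ℕ) :
    ∑ n ∈ Finset.Icc (-(r : ℤ)) r, f n = ∑ s ∈ Finset.range (r + 1), g s := by
  induction r with
  | zero => simp [h0]
  | succ r ih =>
    rw [Finset.sum_range_succ, ← ih, hg, Nat.cast_succ, Finset.Icc_succ_succ,
      Finset.sum_union (by simp), Finset.sum_pair (by omega)]
    ring

section

variable (q : ℂ) (m κ : ℕ)

/-- The theta series of the theorem, folded onto the non-negative indices. -/
noncomputable def foldedTheta : ℕ → ℂ :=
  thetaPair (q ^ (2 * (m + κ + 1))) (q ^ κ) (q ^ (κ + 2 * (m + 1)))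

/-- With `k = κ + i`, the exponent `ks² - is` equals `κs² + i(s² - s)`, and `s² - s` is written `2 *
s.choose 2` to stay in `ℕ`. -/
theorem foldedTheta_succ (s : ℕ) :
    foldedTheta q m κ (s + 1) = (-1) ^ (s + 1) *
      (q ^ (κ * (s + 1) ^ 2 + (m + 1) * (2 * (s + 1).choose 2)) +
        q ^ (κ * (s + 1) ^ 2 + (m + 1) * (2 * (s + 1).choose 2) + 2 * (m + 1) * (s + 1))) := by
  have h := two_mul_choose_two_add (s + 1)
  rw [foldedTheta, thetaPair, ← h, mul_assoc, mul_add, ← pow_mul, ← pow_mul, ← pow_mul, ← pow_add,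
    ← pow_add]
  congr 3 <;> ring

theorem sum_Icc_eq_sum_foldedTheta (r : ℕ) :
    ∑ n ∈ Finset.Icc (-(r : ℤ)) r, (-1 : ℂ) ^ n *
        q ^ (((m + κ + 1 : ℕ) : ℤ) * n ^ 2 - ((m + 1 : ℕ) : ℤ) * n) =
      ∑ s ∈ Finset.range (r + 1), foldedTheta q m κ s := by
  refine sum_Icc_neg_eq_sum_range _ (by simp [foldedTheta, thetaPair]) (fun s => ?_) r
  have h : (2 * (s + 1).choose 2 + (s + 1) : ℤ) = (s + 1) ^ 2 := by
    exact_mod_cast two_mul_choose_two_add (s + 1)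
  have e1 : ((m + κ + 1 : ℕ) : ℤ) * ((s : ℤ) + 1) ^ 2 - ((m + 1 : ℕ) : ℤ) * ((s : ℤ) + 1) =
      ((κ * (s + 1) ^ 2 + (m + 1) * (2 * (s + 1).choose 2) : ℕ) : ℤ) := by
    push_cast
    linear_combination -((m : ℤ) + 1) * h
  have e2 : ((m + κ + 1 : ℕ) : ℤ) * (-((s : ℤ) + 1)) ^ 2 - ((m + 1 : ℕ) : ℤ) * (-((s : ℤ) + 1)) =
      ((κ * (s + 1) ^ 2 + (m + 1) * (2 * (s + 1).choose 2) + 2 * (m + 1) * (s + 1) : ℕ) : ℤ) := by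
    push_cast
    linear_combination -((m : ℤ) + 1) * h
  have e3 : (-1 : ℂ) ^ (-((s : ℤ) + 1)) = (-1) ^ (s + 1) := by
    rw [zpow_neg, ← Nat.cast_succ, zpow_natCast, ← inv_pow]
    norm_num
  have e4 : (-1 : ℂ) ^ ((s : ℤ) + 1) = (-1) ^ (s + 1) := by
    rw [← Nat.cast_succ, zpow_natCast]
  rw [e1, e2, e3, e4, zpow_natCast, zpow_natCast, foldedTheta_succ, mul_add]

end

section

variable {q : ℂ} {m κ : ℕ}

theorem norm_pow_lt_one {q : ℂ} (hq : ‖q‖ < 1) {n : ℕ} (hn : n ≠ 0) : ‖q ^ n‖ < 1 := by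
  rw [norm_pow]
  exact pow_lt_one₀ (norm_nonneg q) hq hn

theorem tsum_foldedTheta (hq : ‖q‖ < 1) (hκ : κ ≠ 0) :
    (Summable fun s => foldedTheta q m κ s) ∧
      ∑' s, foldedTheta q m κ s = evenProduct (m + κ + 1) (m + 1) q := by
  have ha := norm_pow_lt_one hq hκ
  have hb := norm_pow_lt_one hq (show κ + 2 * (m + 1) ≠ 0 by omega)
  have hp := norm_pow_lt_one hq (show 2 * (m + κ + 1) ≠ 0 by omega)
  refine ⟨(summable_norm_thetaPair hp ha hb).of_norm, ?_⟩
  rw [evenProduct, show m + κ + 1 - (m + 1) = κ by omega,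
    show m + κ + 1 + (m + 1) = κ + 2 * (m + 1) by omega]
  refine jacobi_triple_product ha hb ?_
  rw [← pow_add]
  congr 1
  ring

theorem evenProduct_ne_zero (hq : ‖q‖ < 1) (hκ : κ ≠ 0) :
    evenProduct (m + κ + 1) (m + 1) q ≠ 0 := by
  rw [evenProduct]
  refine mul_ne_zero (mul_ne_zero ?_ ?_) ?_
  all_goals exact qPochInf_pow_ne_zero hq (by omega) (by omega)

theorem summable_pow_of_le (hq : ‖q‖ < 1) {t : ℕ → ℕ} (ht : ∀ n, n ≤ t n) :
    Summable fun n => ‖q ^ t n‖ := by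
  refine Summable.of_nonneg_of_le (fun _ => norm_nonneg _) (fun n => ?_)
    (summable_geometric_of_lt_one (norm_nonneg q) hq)
  rw [norm_pow]
  exact pow_le_pow_of_le_one (norm_nonneg q) hq.le (ht n)

theorem chainCoeff_succ (q : ℂ) (e i κ n : ℕ) :
    chainCoeff q e i κ (n + 1) =
      q ^ (i * ((n + 1) ^ 2 + e * (n + 1)) + κ * ((n + 1) ^ 2 + (e + 1) * (n + 1))) -
      q ^ (i * ((n + 1) ^ 2 + e * (n + 1)) + κ * (n ^ 2 + (e + 1) * n)) := by
  rw [chainCoeff, mul_sub, ← pow_add, ← pow_add]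

theorem summable_chainCoeff (hq : ‖q‖ < 1) (e : ℕ) :
    Summable fun n => ‖chainCoeff q e (m + 1) κ n‖ := by
  rw [← summable_nat_add_iff 1]
  have h1 := summable_pow_of_le hq (t := fun n => (m + 1) * ((n + 1) ^ 2 + e * (n + 1)) +
    κ * ((n + 1) ^ 2 + (e + 1) * (n + 1))) fun n => by
      nlinarith [Nat.zero_le (m * (n + 1) ^ 2), Nat.zero_le ((m + 1) * (e * (n + 1))),
        Nat.zero_le (κ * ((n + 1) ^ 2 + (e + 1) * (n + 1)))]
  have h2 := summable_pow_of_le hq (t := fun n => (m + 1) * ((n + 1) ^ 2 + e * (n + 1)) +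
    κ * (n ^ 2 + (e + 1) * n)) fun n => by
      nlinarith [Nat.zero_le (m * (n + 1) ^ 2), Nat.zero_le ((m + 1) * (e * (n + 1))),
        Nat.zero_le (κ * (n ^ 2 + (e + 1) * n))]
  refine Summable.of_nonneg_of_le (fun _ => norm_nonneg _) (fun n => ?_) (h1.add h2)
  rw [chainCoeff_succ]
  exact norm_sub_le _ _

/-- The prefactor completes the squares: the first power in `α_n` yields the theta term of index `n
+ ℓ`, and the second power in `α_{n+1}` the one of index `-(n + ℓ)`. -/
theorem tsum_chainCoeff (hq : ‖q‖ < 1) (r : ℕ) :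
    (-1) ^ (r + 1) * q ^ (κ * (r + 1) ^ 2 + (m + 1) * (2 * (r + 1).choose 2)) *
        ∑' n, (-1) ^ n * chainCoeff q (2 * r + 1) (m + 1) κ n =
      ∑' n, foldedTheta q m κ (n + (r + 1)) := by
  set e := 2 * r + 1 with he
  set A : ℕ → ℂ := fun n => (-1) ^ n * q ^ ((m + 1) * (n ^ 2 + e * n) + κ * (n ^ 2 + (e + 1) * n))
    with hA
  -- The subtracted half of `α_{n+1}`, moved down one index; its minus sign is absorbed into
  -- `(-1)^n`.
  set B : ℕ → ℂ := fun n =>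
    (-1) ^ n * q ^ ((m + 1) * ((n + 1) ^ 2 + e * (n + 1)) + κ * (n ^ 2 + (e + 1) * n)) with hB
  have sA : Summable A := by
    refine Summable.of_norm ((summable_pow_of_le hq (t := fun n =>
      (m + 1) * (n ^ 2 + e * n) + κ * (n ^ 2 + (e + 1) * n)) fun n => ?_).congr fun n => ?_)
    · nlinarith [Nat.zero_le (n ^ 2), Nat.zero_le (m * (n ^ 2 + e * n)), Nat.zero_le (r * n),
        Nat.zero_le (κ * (n ^ 2 + (e + 1) * n))]
    · simp [hA]
  have sB : Summable B := by
    refine Summable.of_norm ((summable_pow_of_le hq (t := fun n =>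
      (m + 1) * ((n + 1) ^ 2 + e * (n + 1)) + κ * (n ^ 2 + (e + 1) * n)) fun n => ?_).congr
      fun n => ?_)
    · nlinarith [Nat.zero_le (m * ((n + 1) ^ 2 + e * (n + 1))), Nat.zero_le (e * (n + 1)),
        Nat.zero_le (κ * (n ^ 2 + (e + 1) * n))]
    · simp [hB]
  have sC : Summable fun n => (-1) ^ n * chainCoeff q e (m + 1) κ n :=
    Summable.of_norm ((summable_chainCoeff (m := m) (κ := κ) hq e).congr fun n => by simp)
  have h1 : ∑' n, (-1) ^ n * chainCoeff q e (m + 1) κ n = ∑' n, (A n + B n) := by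
    rw [sC.tsum_eq_zero_add, sA.tsum_add sB, sA.tsum_eq_zero_add, add_assoc,
      ← ((summable_nat_add_iff 1).mpr sA).tsum_add sB]
    refine congrArg₂ (· + ·) ?_ ?_
    · simp [chainCoeff, hA]
    · refine tsum_congr fun n => ?_
      rw [chainCoeff_succ]
      simp only [hA, hB]
      ring
  rw [h1, ← tsum_mul_left]
  refine tsum_congr fun n => ?_
  have hr := two_mul_choose_two_add (r + 1)
  have hn := two_mul_choose_two_add (n + r + 1)
  have hd : 2 * (n + r + 1).choose 2 = n ^ 2 + e * n + 2 * (r + 1).choose 2 := by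
    rw [he]
    nlinarith
  rw [← add_assoc, foldedTheta_succ, hd]
  simp only [hA, hB, he]
  generalize (r + 1).choose 2 = c
  ring

end

theorem mainTheorem2 (k i ℓ : ℕ) (hi : 1 ≤ i) (hik : i + 1 ≤ k) (hℓ : 1 ≤ ℓ)
    (q : ℂ) (hq : ‖q‖ < 1) :
    ∃ V : ℂ, HasAbelMultisum (evenTerm k i ℓ q) V ∧
      1 / evenProduct k i q *
          ∑ n ∈ Finset.Icc (-(ℓ : ℤ) + 1) ((ℓ : ℤ) - 1),
            (-1 : ℂ) ^ n * q ^ ((k : ℤ) * n ^ 2 - (i : ℤ) * n) =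
        1 + 2 * (-1) ^ (ℓ - 1) * q ^ ((k : ℤ) * (ℓ : ℤ) ^ 2 - (i : ℤ) * (ℓ : ℤ)) /
            evenProduct k i q * V := by
  obtain ⟨m, rfl⟩ := Nat.exists_eq_add_of_le' hi
  obtain ⟨r, rfl⟩ := Nat.exists_eq_add_of_le' hℓ
  -- Here `κ = k - i`; its positivity gives `|q^(k-i)| < 1` and a nonzero product.
  obtain ⟨κ, hκ, rfl⟩ : ∃ κ, κ ≠ 0 ∧ k = m + κ + 1 := ⟨k - m - 1, by omega, by omega⟩
  refine ⟨_, hasAbelMultisum_evenTerm hq m κ r (summable_chainCoeff hq _), ?_⟩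
  obtain ⟨hs, ht⟩ := tsum_foldedTheta (m := m) hq hκ
  have hE := evenProduct_ne_zero (m := m) hq hκ
  have hc : (2 * (r + 1).choose 2 + (r + 1) : ℤ) = (r + 1) ^ 2 := by
    exact_mod_cast two_mul_choose_two_add (r + 1)
  have he : ((m + κ + 1 : ℕ) : ℤ) * ((r + 1 : ℕ) : ℤ) ^ 2 - ((m + 1 : ℕ) : ℤ) * ((r + 1 : ℕ) : ℤ) =
      ((κ * (r + 1) ^ 2 + (m + 1) * (2 * (r + 1).choose 2) : ℕ) : ℤ) := by
    push_cast
    linear_combination -((m : ℤ) + 1) * hc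
  rw [he, zpow_natCast, show -((r + 1 : ℕ) : ℤ) + 1 = -(r : ℤ) by push_cast; ring,
    show ((r + 1 : ℕ) : ℤ) - 1 = r by push_cast; ring, sum_Icc_eq_sum_foldedTheta, tsum_mul_right,
    Nat.add_sub_cancel]
  -- Cut the theta series at `ℓ`. The tail has sign `(-1)^ℓ`, opposite to `(-1)^(ℓ-1)`, and the `2`
  -- in the statement cancels the `1/2` in the Abel sum.
  have hsplit := hs.sum_add_tsum_nat_add (r + 1)
  rw [ht, ← tsum_chainCoeff hq] at hsplit
  field_simp
  linear_combination hsplit
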